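/- Let $\mathcal H^1$ be the one-dimensional Hausdorff measure in $\mathbb R^2$, and let $K\subset\mathbb R^2$ be compact and connected with $\mathcal H^1(K)<\infty$. For $\mathcal H^1$-a.e. $x\in K$, the set $K$ has an approximate tangent line at $x$; let $\tau_K(x)$ be a unit vector in its direction. For $\varphi\in C^\infty(\mathbb R^2)$ set $$N(\varphi)=\Big(\int_K\varphi^2\,d\mathcal H^1+\int_K|\nabla\varphi\cdot\tau_K|^2\,d\mathcal H^1\Big)^{1/2}.$$ Let $H^1(K)$ be the completion for the norm $N$ of the space of restrictions to $K$ of functions in $C^\infty(\mathbb R^2)$: an element $u$ of $H^1(K)$ is given by a sequence $\varphi_n\in C^\infty(\mathbb R^2)$ that is Cauchy for $N$ (two such sequences being identified if the $N$-norm of their difference tends to $0$). As a function, $u\in L^2(K,\mathcal H^1)$ is the limit of $\varphi_n$ in $L^2(K,\mathcal H^1)$, and its tangential gradient $\nabla_K u\in L^2(K,\mathcal H^1;\mathbb R^2)$ is the limit of $(\nabla\varphi_n\cdot\tau_K)\tau_K$. For $x,y\in K$ let $$\mathrm{dist}_K(x,y)=\inf\Big\{\int_0^1|\gamma'(t)|\,dt\;:\;\gamma:[0,1]\to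 K\text{ Lipschitz},\ \gamma(0)=x,\ \gamma(1)=y\Big\}$$ be the geodesic distance on $K$. Then, for every $u\in H^1(K)$, $$|u(x)-u(y)|\le \mathrm{dist}_K(x,y)^{1/2}\,\|\nabla_K u\|_{L^2(K)}\qquad\text{for }\mathcal H^1\text{-a.e. }x,y\in K,$$ that is, for all $x,y\in K$ outside some $\mathcal H^1$-null set. Consequently, every $u\in H^1(K)$ coincides $\mathcal H^1$-a.e. on $K$ with a continuous function on $K$. -/

import Mathlib

open MeasureTheory Filter Topology Set
open scoped ENNReal ContDiff

noncomputable section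

namespace RoadField

/-- The Euclidean plane `ℝ²`. -/
abbrev Plane : Type := EuclideanSpace ℝ (Fin 2)

/-- The measure `H¹` restricted to `K`, where `H¹` is the one-dimensional Hausdorff measure. -/
def lengthMeasure (K : Set Plane) : Measure Plane :=
  (Measure.hausdorffMeasure 1 : Measure Plane).restrict K

/-- The open two-sided cone with vertex `x`, axis `x + ℝ e` (where `e` is a unit vector) and
opening `s`: the points `y` whose distance to the axis, which is
`‖(y - x) - ⟪e, y - x⟫ e‖`, is smaller than `s ‖y - x‖`. -/
def cone (x e : Plane) (s : ℝ) : Set Plane :=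
  {y | ‖(y - x) - (inner ℝ e (y - x) : ℝ) • e‖ < s * ‖y - x‖}

/-- `e` is a unit vector spanning an approximate tangent line of `K` at `x`: the set `K` has
positive upper `H¹`-density at `x`, and the part of `K` outside any cone around the line `x + ℝ e`
has `H¹`-density zero at `x`. -/
structure IsApproxTangent (K : Set Plane) (x e : Plane) : Prop where
  norm_eq_one : ‖e‖ = 1
  upper_density_pos :
    0 < limsup (fun r : ℝ => lengthMeasure K (Metric.closedBall x r) / ENNReal.ofReal r) (𝓝[>] 0)
  density_outside_cone : ∀ s : ℝ, 0 < s → s < 1 →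
    Tendsto (fun r : ℝ =>
      lengthMeasure K (Metric.closedBall x r \ cone x e s) / ENNReal.ofReal r) (𝓝[>] 0) (𝓝 0)

open Classical in
/-- A choice `τ_K` of a unit tangent vector at the points of `K` where an approximate tangent line
exists (that line is then unique, so that `τ_K` is determined up to sign), and `0` elsewhere. -/
def tangent (K : Set Plane) (x : Plane) : Plane :=
  if h : ∃ e : Plane, x ∈ K ∧ IsApproxTangent K x e then h.choose else 0

/-- The projection `(∇φ · τ_K) τ_K` of the gradient of `φ` on the tangent line of `K`. -/
def smoothTangentialGradient (K : Set Plane) (φ : Plane → ℝ) (x : Plane) : Plane :=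
  (inner ℝ (gradient φ x) (tangent K x) : ℝ) • tangent K x

/-- The Hilbert space `L²(K) × L²(K; ℝ²)`, with `‖(u, g)‖² = ‖u‖² + ‖g‖²`. -/
abbrev L2Pair (K : Set Plane) : Type :=
  WithLp 2 (Lp ℝ 2 (lengthMeasure K) × Lp Plane 2 (lengthMeasure K))

/-- The space `D(K)` of restrictions to `K` of functions `φ ∈ C^∞(ℝ²)`, where `φ` is represented by
the pair `(φ, (∇φ · τ_K) τ_K)` of elements of `L²`. (If `K` is compact and `H¹(K) < ∞`, then every
`φ` gives such a pair: the two functions are bounded on `K`, and `(∇φ · τ_K) τ_K` is measurable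
whatever the choice of the signs of `τ_K`.) The norm of this pair is
`N(φ) = (∫_K φ² dH¹ + ∫_K |∇φ · τ_K|² dH¹)^(1/2)`. -/
def smoothPairs (K : Set Plane) : Submodule ℝ (L2Pair K) where
  carrier := {p | ∃ φ : Plane → ℝ, ContDiff ℝ ∞ φ ∧
    (p.fst : Plane → ℝ) =ᵐ[lengthMeasure K] φ ∧
    (p.snd : Plane → Plane) =ᵐ[lengthMeasure K] smoothTangentialGradient K φ}
  zero_mem' := by
    refine ⟨0, contDiff_const, Lp.coeFn_zero _ _ _, ?_⟩
    filter_upwards [Lp.coeFn_zero Plane 2 (lengthMeasure K)] with x hx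
    have h : gradient (0 : Plane → ℝ) x = 0 := gradient_const x (0 : ℝ)
    simp [smoothTangentialGradient, h]
    simpa using hx
  add_mem' := by
    rintro p q ⟨φ, hφ, h1, h2⟩ ⟨ψ, hψ, h3, h4⟩
    refine ⟨φ + ψ, hφ.add hψ, (Lp.coeFn_add p.fst q.fst).trans (h1.add h3),
      (Lp.coeFn_add p.snd q.snd).trans ?_⟩
    filter_upwards [h2, h4] with x hx hy
    have h : gradient (φ + ψ) x = gradient φ x + gradient ψ x := by
      simp only [gradient]
      rw [fderiv_add (hφ.differentiable (by simp) x) (hψ.differentiable (by simp) x), map_add]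
    simp [smoothTangentialGradient, h, hx, hy, inner_add_left, add_smul]
  smul_mem' := by
    rintro c p ⟨φ, hφ, h1, h2⟩
    refine ⟨c • φ, contDiff_const.smul hφ, (Lp.coeFn_smul c p.fst).trans (h1.const_smul c),
      (Lp.coeFn_smul c p.snd).trans ?_⟩
    filter_upwards [h2] with x hx
    have h : gradient (c • φ) x = c • gradient φ x := by
      simp only [gradient]
      rw [fderiv_const_smul (hφ.differentiable (by simp) x), map_smul]
    simp [smoothTangentialGradient, h, hx, inner_smul_left, mul_smul]

/-- The space `H¹(K)`: the completion of `D(K)` for the norm `N`, realized as the closure of `D(K)`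
in the complete space `L²(K) × L²(K; ℝ²)`. -/
def SobolevH1 (K : Set Plane) : Submodule ℝ (L2Pair K) :=
  (smoothPairs K).topologicalClosure

/-- The function in `L²(K)` given by an element of `H¹(K)`, i.e. the limit in `L²(K)` of the smooth
functions `φₙ` that converge to it for the norm `N`. -/
def toL2 {K : Set Plane} (u : SobolevH1 K) : Lp ℝ 2 (lengthMeasure K) :=
  (u : L2Pair K).fst

/-- The tangential gradient `∇_K u ∈ L²(K; ℝ²)` of `u ∈ H¹(K)`, i.e. the limit in `L²(K; ℝ²)` of
`(∇φₙ · τ_K) τ_K` for smooth functions `φₙ` that converge to `u` for the norm `N`. -/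
def tangentialGradient {K : Set Plane} (u : SobolevH1 K) :
    Lp Plane 2 (lengthMeasure K) :=
  (u : L2Pair K).snd

/-- The geodesic distance on `K`: the infimum of the lengths `∫₀¹ |γ'(t)| dt` of the Lipschitz
curves `γ : [0,1] → K` from `x` to `y`. (The infimum of the empty set would be `0` here, which is
of no help in an upper bound by `geodesicDist`.) -/
def geodesicDist (K : Set Plane) (x y : Plane) : ℝ :=
  sInf {ℓ : ℝ | ∃ γ : ℝ → Plane, (∃ C, LipschitzOnWith C γ (Icc 0 1)) ∧ MapsTo γ (Icc 0 1) K ∧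
    γ 0 = x ∧ γ 1 = y ∧ ℓ = ∫ t in (0 : ℝ)..1, ‖deriv γ t‖}

end RoadField

end

/-! For smooth `φ` and distinct points of `K`, join them by an injective Lipschitz curve `γ` in `K`
whose constant `L` is at most their geodesic distance. Where `γ' ≠ 0`, for almost every parameter,
`γ'` spans the approximate tangent of `K`, so `|(φ ∘ γ)'| ≤ |γ'| |∇_K φ| ∘ γ`. By injectivity the
image of `|γ'| dt` under `γ` is at most `H¹` on `K`, and its mass is at most `L`. Cauchy–Schwarz
gives `|φ x - φ y| ≤ L^(1/2) ‖∇_K φ‖`, which passes to the limit at points where a subsequence of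
the approximations converges.

The curve comes from `exists_lipschitz_curve` (limits of discrete chains) and from minimizing the
Lipschitz constant; minimality forces injectivity. The measure bound is
`map_withDensity_enorm_deriv_le`. The tangent is identified by `isApproxTangent_of_hasDerivAt`,
because `K` minus the curve has density zero at almost every point of the curve, and by uniqueness
of approximate tangents.

For continuity, `L ≤ 4 H¹(K)` makes the smooth approximations uniformly Cauchy on `K` once they
converge at one point. -/

open scoped NNReal

/-! ### Lipschitz curves in continua of finite length -/

section Continua

variable {X : Type*} [MetricSpace X]

theorem IsCompact.exists_finset_isSeparated_isCover {K : Set X} (hK : IsCompact K) {ε : ℝ≥0}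
    (hε : ε ≠ 0) : ∃ S : Finset X, (S : Set X) ⊆ K ∧ Metric.IsSeparated (ε : ℝ≥0∞) (S : Set X) ∧
      ∀ z ∈ K, ∃ s ∈ S, dist z s ≤ ε := by
  have hfin : Metric.packingNumber ε K ≠ ⊤ := by
    obtain ⟨N, -, hN, hcov⟩ := Metric.exists_finite_isCover_of_isCompact
      (show ε / 2 ≠ 0 by positivity) hK
    have h := (Metric.packingNumber_two_mul_le_externalCoveringNumber (ε / 2) K).trans
      hcov.externalCoveringNumber_le_encard
    rw [mul_div_cancel₀ _ two_ne_zero] at h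
    exact ne_top_of_le_ne_top hN.encard_lt_top.ne h
  have hSfin : (Metric.maximalSeparatedSet ε K).Finite := by
    rw [← encard_ne_top_iff, Metric.encard_maximalSeparatedSet hfin]
    exact hfin
  refine ⟨hSfin.toFinset, ?_, ?_, fun z hz => ?_⟩
  · simpa using Metric.maximalSeparatedSet_subset
  · simpa using Metric.isSeparated_maximalSeparatedSet
  · obtain ⟨s, hs, hzs⟩ := Metric.isCover_maximalSeparatedSet hfin hz
    refine ⟨s, by simpa using hs, ?_⟩
    have h : edist z s ≤ ε := hzs
    rwa [edist_nndist, ENNReal.coe_le_coe] at h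

/-- Otherwise the balls around reachable centres and those around unreachable ones form two closed
sets covering `K`. By connectedness they meet in `K`, and a common point links a reachable centre to
an unreachable one. -/
theorem reflTransGen_of_isPreconnected {K : Set X} (hconn : IsPreconnected K) {ε : ℝ}
    {S : Finset X} (hS : (S : Set X) ⊆ K) (hcov : ∀ z ∈ K, ∃ s ∈ S, dist z s ≤ ε) (a b : S) :
    Relation.ReflTransGen (fun s t : S => s ≠ t ∧ dist (s : X) t ≤ 2 * ε) a b := by
  classical
  set R := Relation.ReflTransGen (fun s t : S => s ≠ t ∧ dist (s : X) t ≤ 2 * ε)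
  by_contra hab
  have hclosed : ∀ P : S → Prop, IsClosed (⋃ s : {s : S // P s}, Metric.closedBall (s : X) ε) :=
    fun P => isClosed_iUnion_of_finite fun _ => Metric.isClosed_closedBall
  have hε : 0 ≤ ε := by
    obtain ⟨s, -, hs⟩ := hcov a (hS a.2)
    exact dist_nonneg.trans hs
  obtain ⟨z, -, hz1, hz2⟩ := isPreconnected_closed_iff.1 hconn _ _ (hclosed (R a))
    (hclosed fun s => ¬ R a s)
    (by
      intro z hz
      obtain ⟨s, hs, hzs⟩ := hcov z hz
      by_cases h : R a ⟨s, hs⟩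
      · exact Or.inl (mem_iUnion.2 ⟨⟨⟨s, hs⟩, h⟩, hzs⟩)
      · exact Or.inr (mem_iUnion.2 ⟨⟨⟨s, hs⟩, h⟩, hzs⟩))
    ⟨a, hS a.2, mem_iUnion.2 ⟨⟨a, Relation.ReflTransGen.refl⟩, Metric.mem_closedBall_self hε⟩⟩
    ⟨b, hS b.2, mem_iUnion.2 ⟨⟨b, hab⟩, Metric.mem_closedBall_self hε⟩⟩
  obtain ⟨⟨s, hs⟩, hzs⟩ := mem_iUnion.1 hz1
  obtain ⟨⟨t, ht⟩, hzt⟩ := mem_iUnion.1 hz2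
  refine ht (hs.tail ⟨?_, ?_⟩)
  · rintro rfl
    exact ht hs
  · have := dist_triangle_left (s : X) t z
    rw [Metric.mem_closedBall] at hzs hzt
    simp only at hzs hzt
    linarith

/-- A curve with the least Lipschitz constant among the curves in `K` from `x` to `y`. -/
theorem exists_minimal_lipschitz_curve {K : Set X} (hK : IsCompact K) {x y : X} {C : ℝ≥0}
    (h : ∃ γ : ℝ → X, LipschitzWith C γ ∧ (∀ t, γ t ∈ K) ∧ γ 0 = x ∧ γ 1 = y) :
    ∃ (L : ℝ≥0) (γ : ℝ → X), LipschitzWith L γ ∧ (∀ t, γ t ∈ K) ∧ γ 0 = x ∧ γ 1 = y ∧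
      ∀ (L' : ℝ≥0) (γ' : ℝ → X), LipschitzWith L' γ' → (∀ t, γ' t ∈ K) → γ' 0 = x → γ' 1 = y →
        L ≤ L' := by
  obtain ⟨γ₀, h1, h2, h3, h4⟩ := h
  -- Every condition on the pair (constant, curve) is closed for pointwise convergence, so
  -- Tychonoff's theorem suffices for compactness.
  let T : Set (ℝ≥0 × (ℝ → X)) := (Icc 0 C ×ˢ Set.univ.pi fun _ => K) ∩
    ({p | p.2 0 = x} ∩ {p | p.2 1 = y} ∩
      ⋂ (s : ℝ) (t : ℝ), {p | dist (p.2 s) (p.2 t) ≤ p.1 * dist s t})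
  have hev : ∀ t : ℝ, Continuous fun p : ℝ≥0 × (ℝ → X) => p.2 t := fun t =>
    (continuous_apply t).comp continuous_snd
  have hT : IsCompact T := by
    refine (isCompact_Icc.prod (isCompact_univ_pi fun _ => hK)).inter_right ?_
    refine ((isClosed_eq (hev 0) continuous_const).inter
      (isClosed_eq (hev 1) continuous_const)).inter ?_
    refine isClosed_iInter fun s => isClosed_iInter fun t => isClosed_le ((hev s).dist (hev t)) ?_
    exact (NNReal.continuous_coe.comp continuous_fst).mul continuous_const
  have hmem : ∀ (L' : ℝ≥0) (γ' : ℝ → X), L' ≤ C → LipschitzWith L' γ' → (∀ t, γ' t ∈ K) →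
      γ' 0 = x → γ' 1 = y → (L', γ') ∈ T := fun L' γ' h0 ha hb hc hd =>
    ⟨⟨⟨zero_le, h0⟩, fun t _ => hb t⟩, ⟨hc, hd⟩, by
      simp only [mem_iInter, mem_ofPred_eq]
      exact ha.dist_le_mul⟩
  obtain ⟨⟨L, γ⟩, hm, hmin⟩ := hT.exists_isMinOn ⟨_, hmem C γ₀ le_rfl h1 h2 h3 h4⟩
    (continuous_fst.continuousOn)
  have hLC : L ≤ C := hm.1.1.2
  refine ⟨L, γ, LipschitzWith.of_dist_le_mul ?_, fun t => hm.1.2 t trivial, hm.2.1.1, hm.2.1.2,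
    fun L' γ' ha hb hc hd => ?_⟩
  · simpa using hm.2.2
  · rcases le_total L' C with h | h
    · exact hmin (hmem L' γ' h ha hb hc hd)
    · exact hLC.trans h

/-- If `γ s = γ t`, cutting out the loop and stretching the remaining parameter interval back to
unit length multiplies the constant by `1 - (t - s) < 1`. -/
theorem injOn_of_minimal_lipschitz {K : Set X} {x y : X} (hxy : x ≠ y) {L : ℝ≥0} {γ : ℝ → X}
    (hγ : LipschitzWith L γ) (hγK : ∀ t, γ t ∈ K) (h0 : γ 0 = x) (h1 : γ 1 = y)
    (hmin : ∀ (L' : ℝ≥0) (γ' : ℝ → X), LipschitzWith L' γ' → (∀ t, γ' t ∈ K) → γ' 0 = x →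
      γ' 1 = y → L ≤ L') : InjOn γ (Icc 0 1) := by
  have hL : 0 < L := by
    rw [pos_iff_ne_zero]
    rintro rfl
    have := hγ.dist_le_mul 0 1
    rw [h0, h1] at this
    exact hxy (dist_le_zero.1 (by simpa using this))
  suffices H : ∀ s ∈ Icc (0 : ℝ) 1, ∀ t ∈ Icc (0 : ℝ) 1, s < t → γ s ≠ γ t by
    intro s hs t ht hst
    by_contra hne
    rcases lt_or_gt_of_ne hne with h | h
    · exact H s hs t ht h hst
    · exact H t ht s hs h hst.symm
  intro s hs t ht hst heq
  set q : ℝ := 1 - (t - s) with hq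
  have hq0 : 0 ≤ q := by linarith [ht.2, hs.1]
  have hq1 : q < 1 := by linarith
  -- run along `γ` at speed `q`, skipping the loop on `[s, t]`
  let γ' : ℝ → X := fun r => if q * r ≤ s then γ (q * r) else γ (q * r + (t - s))
  have key : ∀ r r', r ≤ r' → dist (γ' r) (γ' r') ≤ L * q * |r - r'| := by
    intro r r' hrr
    have hm : q * r ≤ q * r' := mul_le_mul_of_nonneg_left hrr hq0
    rw [abs_sub_comm, abs_of_nonneg (sub_nonneg.2 hrr), mul_assoc, mul_sub]
    by_cases h' : q * r' ≤ s
    · simp only [γ', if_pos h', if_pos (hm.trans h')]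
      refine (hγ.dist_le_mul _ _).trans_eq ?_
      rw [dist_comm, Real.dist_eq, abs_of_nonneg (by linarith)]
    · by_cases h : q * r ≤ s
      · simp only [γ', if_pos h, if_neg h']
        refine (dist_triangle _ (γ s) _).trans ?_
        have ha := hγ.dist_le_mul (q * r) s
        have hb := hγ.dist_le_mul t (q * r' + (t - s))
        rw [dist_comm (q * r), Real.dist_eq, abs_of_nonneg (by linarith)] at ha
        rw [dist_comm t, Real.dist_eq, abs_of_nonneg (by linarith), ← heq] at hb
        calc _ ≤ (L : ℝ) * (s - q * r) + L * (q * r' + (t - s) - t) := add_le_add ha hb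
          _ = _ := by ring
      · simp only [γ', if_neg h', if_neg h]
        refine (hγ.dist_le_mul _ _).trans_eq ?_
        rw [dist_comm, Real.dist_eq, abs_of_nonneg (by linarith)]
        ring
  have hlt : L * ⟨q, hq0⟩ < L := mul_lt_of_lt_one_right hL hq1
  refine hlt.not_ge (hmin _ γ' (LipschitzWith.of_dist_le_mul fun r r' => ?_) (fun r => ?_) ?_ ?_)
  · rcases le_total r r' with h | h
    · exact key r r' h
    · rw [dist_comm, dist_comm r]
      exact key r' r h
  · simp only [γ']
    split_ifs <;> exact hγK _
  · simp only [γ', mul_zero, if_pos hs.1, h0]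
  · simp only [γ', mul_one]
    split_ifs with h
    · have hs1 : s = q := by linarith [ht.2]
      have ht1 : t = 1 := by linarith
      rw [← hs1, heq, ht1, h1]
    · rw [hq, sub_add_cancel, h1]

variable [MeasurableSpace X] [BorelSpace X]

/-- The distance to `x` is 1-Lipschitz, and by the intermediate value theorem it takes all values of
`[0, r]` on the part of `C` in the ball. -/
theorem IsPreconnected.ofReal_le_hausdorffMeasure_inter_closedBall {C : Set X}
    (hC : IsPreconnected C) {x y : X} (hx : x ∈ C) (hy : y ∈ C) {r : ℝ} (hr : r ≤ dist y x) :
    ENNReal.ofReal r ≤ Measure.hausdorffMeasure 1 (C ∩ Metric.closedBall x r) := by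
  have hf : LipschitzWith 1 (fun z : X => dist z x) := LipschitzWith.dist_left x
  have hsub : Icc 0 r ⊆ (fun z : X => dist z x) '' (C ∩ Metric.closedBall x r) := by
    rintro t ⟨ht0, htr⟩
    obtain ⟨z, hz, hzt⟩ := hC.intermediate_value hx hy hf.continuous.continuousOn
      (show t ∈ Icc (dist x x) (dist y x) by simp only [dist_self]; exact ⟨ht0, htr.trans hr⟩)
    have hzt' : dist z x = t := hzt
    exact ⟨z, ⟨hz, by rw [Metric.mem_closedBall, hzt']; exact htr⟩, hzt⟩
  calc ENNReal.ofReal r = volume (Icc 0 r) := by simp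
    _ = Measure.hausdorffMeasure 1 (Icc 0 r) := by rw [hausdorffMeasure_real]
    _ ≤ _ := measure_mono hsub
    _ ≤ (1 : ℝ≥0) ^ (1 : ℝ) * Measure.hausdorffMeasure 1 (C ∩ Metric.closedBall x r) :=
        hf.hausdorffMeasure_image_le zero_le_one _
    _ = _ := by simp

theorem IsPreconnected.edist_le_hausdorffMeasure {C : Set X}
    (hC : IsPreconnected C) {x y : X} (hx : x ∈ C) (hy : y ∈ C) :
    edist y x ≤ Measure.hausdorffMeasure 1 C := by
  rw [edist_dist]
  exact (hC.ofReal_le_hausdorffMeasure_inter_closedBall hx hy le_rfl).trans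
    (measure_mono inter_subset_left)

/-- The balls of radius `ε / 2` around separated points are disjoint. Each carries length at least
`ε / 2`, since `x` or `y` is at distance at least `ε / 2` from its centre. -/
theorem card_mul_le_hausdorffMeasure {K : Set X} (hconn : IsPreconnected K)
    {x y : X} (hx : x ∈ K) (hy : y ∈ K) {ε : ℝ≥0} (hε : (ε : ℝ) ≤ dist x y)
    {S : Finset X} (hS : (S : Set X) ⊆ K) (hsep : Metric.IsSeparated (ε : ℝ≥0∞) (S : Set X)) :
    S.card * ENNReal.ofReal (ε / 2) ≤ Measure.hausdorffMeasure 1 K := by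
  have hdisj : (S : Set X).PairwiseDisjoint (fun s => Metric.closedBall s (ε / 2 : ℝ)) := by
    intro a ha b hb hab
    have h : (ε : ℝ≥0∞) < edist a b := hsep ha hb hab
    rw [edist_nndist, ENNReal.coe_lt_coe] at h
    have h' : (ε : ℝ) < dist a b := h
    exact Metric.closedBall_disjoint_closedBall (by linarith)
  calc S.card * ENNReal.ofReal (ε / 2) = ∑ s ∈ S, ENNReal.ofReal (ε / 2) := by simp
    _ ≤ ∑ s ∈ S, (Measure.hausdorffMeasure 1 : Measure X).restrict K
          (Metric.closedBall s (ε / 2)) := by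
        refine Finset.sum_le_sum fun s hs => ?_
        rw [Measure.restrict_apply Metric.isClosed_closedBall.measurableSet, inter_comm]
        have hs' := hS hs
        rcases le_total (ε / 2 : ℝ) (dist x s) with h | h
        · exact hconn.ofReal_le_hausdorffMeasure_inter_closedBall hs' hx h
        · refine hconn.ofReal_le_hausdorffMeasure_inter_closedBall hs' hy ?_
          have := dist_triangle_right x y s
          linarith
    _ = (Measure.hausdorffMeasure 1 : Measure X).restrict K
          (⋃ s ∈ S, Metric.closedBall s (ε / 2)) :=
        (measure_biUnion_finset hdisj fun s _ => Metric.isClosed_closedBall.measurableSet).symm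
    _ ≤ (Measure.hausdorffMeasure 1 : Measure X).restrict K univ := measure_mono (subset_univ _)
    _ = _ := by simp

/-- A simple path in an `ε`-net has at most `card S ≤ 2 H / ε` steps, each of length at most `2 ε`.
Run in unit time it has speed at most `4 H`; the term `2 ε` pays for rounding to a vertex. -/
theorem exists_coarse_lipschitz_path {K : Set X} (hK : IsCompact K) (hconn : IsPreconnected K)
    (hfin : Measure.hausdorffMeasure 1 K < ⊤) {x y : X} (hx : x ∈ K) (hy : y ∈ K) {ε : ℝ≥0}
    (hε0 : ε ≠ 0) (hε : (ε : ℝ) ≤ dist x y) :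
    ∃ f : ℝ → X, (∀ t, f t ∈ K) ∧ dist (f 0) x ≤ ε ∧ dist (f 1) y ≤ ε ∧
      ∀ s t, dist (f s) (f t) ≤
        4 * (Measure.hausdorffMeasure 1 K).toReal * |s - t| + 2 * ε := by
  classical
  obtain ⟨S, hS, hsep, hcov⟩ := hK.exists_finset_isSeparated_isCover hε0
  obtain ⟨a, ha, hxa⟩ := hcov x hx
  obtain ⟨b, hb, hyb⟩ := hcov y hy
  have hcard := card_mul_le_hausdorffMeasure hconn hx hy hε hS hsep
  set H := (Measure.hausdorffMeasure 1 K).toReal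
  have hcard' : (S.card : ℝ) * ε ≤ 2 * H := by
    have h := ENNReal.toReal_mono hfin.ne hcard
    rw [ENNReal.toReal_mul, ENNReal.toReal_natCast, ENNReal.toReal_ofReal (by positivity)] at h
    linarith
  let G : SimpleGraph S :=
    { Adj := fun s t => s ≠ t ∧ dist (s : X) t ≤ 2 * ε
      symm := ⟨fun s t h => ⟨h.1.symm, by rw [dist_comm]; exact h.2⟩⟩
      loopless := ⟨fun s h => h.1 rfl⟩ }
  have hreach : G.Reachable ⟨a, ha⟩ ⟨b, hb⟩ :=
    (G.reachable_iff_reflTransGen _ _).2 (reflTransGen_of_isPreconnected hconn hS hcov _ _)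
  obtain ⟨p, hp⟩ := hreach.exists_isPath
  have hlen : p.length ≤ S.card := by simpa using hp.length_lt.le
  set n := p.length with hn
  have hstep : ∀ i, dist (p.getVert i : X) (p.getVert (i + 1)) ≤ 2 * ε := by
    intro i
    rcases lt_or_ge i n with h | h
    · exact (p.adj_getVert_succ h).2
    · rw [p.getVert_of_length_le h, p.getVert_of_length_le (h.trans i.le_succ), dist_self]
      positivity
  have hdist : ∀ i k, dist (p.getVert i : X) (p.getVert (i + k)) ≤ k * (2 * ε) := by
    intro i k
    induction k with
    | zero => simp
    | succ k ih =>
      refine (dist_triangle _ (p.getVert (i + k) : X) _).trans ?_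
      have := hstep (i + k)
      rw [add_assoc] at this
      push_cast
      linarith
  have hmain : ∀ s t : Icc (0 : ℝ) 1, s ≤ t →
      dist (p.getVert ⌊(s : ℝ) * n⌋₊ : X) (p.getVert ⌊(t : ℝ) * n⌋₊) ≤
        4 * H * |(s : ℝ) - t| + 2 * ε := by
    intro s t hst
    have hst' : (s : ℝ) ≤ t := hst
    have hs0 := s.2.1
    obtain ⟨k, hk⟩ := Nat.exists_eq_add_of_le
      (Nat.floor_mono (mul_le_mul_of_nonneg_right hst' (Nat.cast_nonneg n)) :
        ⌊(s : ℝ) * n⌋₊ ≤ ⌊(t : ℝ) * n⌋₊)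
    rw [hk]
    refine (hdist _ k).trans ?_
    have h1 : (⌊(t : ℝ) * n⌋₊ : ℝ) ≤ t * n := Nat.floor_le (by positivity [hs0.trans hst'])
    have h2 := Nat.lt_floor_add_one ((s : ℝ) * n)
    rw [hk] at h1
    push_cast at h1
    have h3 : (k : ℝ) ≤ (t - s) * n + 1 := by linarith
    rw [abs_sub_comm, abs_of_nonneg (sub_nonneg.2 hst')]
    have h4 : (n : ℝ) * ε ≤ 2 * H :=
      (mul_le_mul_of_nonneg_right (Nat.cast_le.2 hlen) ε.2).trans hcard'
    calc (k : ℝ) * (2 * ε) ≤ ((t - s) * n + 1) * (2 * ε) := by gcongr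
      _ = 2 * (t - s) * (n * ε) + 2 * ε := by ring
      _ ≤ 2 * (t - s) * (2 * H) + 2 * ε := by
          have := sub_nonneg.2 hst'
          gcongr
      _ = _ := by ring
  refine ⟨fun t => p.getVert ⌊(projIcc 0 1 zero_le_one t : ℝ) * n⌋₊, fun t => hS (Subtype.coe_prop _),
    ?_, ?_, fun s t => ?_⟩
  · simpa [dist_comm] using hxa
  · simpa [dist_comm, hn] using hyb
  · refine le_trans ?_ (add_le_add_left (mul_le_mul_of_nonneg_left
      (abs_projIcc_sub_projIcc (h := zero_le_one) (c := s) (d := t)) (by positivity)) _)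
    rcases le_total (projIcc 0 1 zero_le_one s) (projIcc 0 1 zero_le_one t) with h | h
    · exact hmain _ _ h
    · rw [dist_comm, abs_sub_comm]
      exact hmain _ _ h

/-- Any two points of a continuum of finite length are joined by a Lipschitz curve in it. -/
theorem exists_lipschitz_curve {K : Set X} (hK : IsCompact K) (hconn : IsPreconnected K)
    (hfin : Measure.hausdorffMeasure 1 K < ⊤) {x y : X} (hx : x ∈ K) (hy : y ∈ K) (hxy : x ≠ y) :
    ∃ γ : ℝ → X, LipschitzWith (4 * (Measure.hausdorffMeasure 1 K).toNNReal) γ ∧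
      (∀ t, γ t ∈ K) ∧ γ 0 = x ∧ γ 1 = y := by
  obtain ⟨u, -, hu0, hu⟩ := exists_seq_strictAnti_tendsto'
    (show 0 < nndist x y from dist_pos.2 hxy)
  have huniv : ∀ n, ∃ f : ℝ → X, (∀ t, f t ∈ K) ∧ dist (f 0) x ≤ u n ∧ dist (f 1) y ≤ u n ∧
      ∀ s t, dist (f s) (f t) ≤
        4 * (Measure.hausdorffMeasure 1 K).toReal * |s - t| + 2 * u n := fun n =>
    exists_coarse_lipschitz_path hK hconn hfin hx hy (hu0 n).1.ne'
      (by rw [dist_nndist]; exact_mod_cast (hu0 n).2.le)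
  choose f hfK hf0 hf1 hf using huniv
  -- The `f n` need not be continuous. An ultrafilter gives limits at all `t` at once, and the
  -- additive error vanishes in the limit.
  have hlim : ∀ t, ∃ z ∈ K, Tendsto (fun n => f n t) (hyperfilter ℕ) (𝓝 z) := by
    intro t
    obtain ⟨z, hz, hle⟩ := hK.ultrafilter_le_nhds ((hyperfilter ℕ).map fun n => f n t)
      (le_principal_iff.2 (Ultrafilter.mem_map.2
        (univ_mem' (f := hyperfilter ℕ) fun n => hfK n t)))
    exact ⟨z, hz, hle⟩
  choose γ hγK hγ using hlim
  have hu' : Tendsto (fun n => (u n : ℝ)) (hyperfilter ℕ) (𝓝 0) :=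
    (NNReal.tendsto_coe.2 hu).mono_left Nat.hyperfilter_le_atTop
  refine ⟨γ, LipschitzWith.of_dist_le_mul fun s t => ?_, hγK, ?_, ?_⟩
  · have h := le_of_tendsto_of_tendsto' ((hγ s).dist (hγ t))
      ((hu'.const_mul 2).const_add (4 * (Measure.hausdorffMeasure 1 K).toReal * |s - t|))
      fun n => hf n s t
    simpa [Real.dist_eq, ENNReal.toReal] using h
  · exact dist_le_zero.1 (le_of_tendsto_of_tendsto' ((hγ 0).dist tendsto_const_nhds) hu' hf0)
  · exact dist_le_zero.1 (le_of_tendsto_of_tendsto' ((hγ 1).dist tendsto_const_nhds) hu' hf1)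

end Continua

/-! ### Length and reparametrization of Lipschitz curves -/

section Arclength

theorem LipschitzWith.intervalIntegrable_norm_deriv {V : Type*} [NormedAddCommGroup V]
    [NormedSpace ℝ V] [FiniteDimensional ℝ V] {C : ℝ≥0} {γ : ℝ → V} (hγ : LipschitzWith C γ)
    (a b : ℝ) : IntervalIntegrable (fun t => ‖deriv γ t‖) volume a b := by
  have : CompleteSpace V := FiniteDimensional.complete ℝ V
  refine (intervalIntegrable_const (c := (C : ℝ))).mono_fun ?_ ?_
  · exact (stronglyMeasurable_deriv γ).norm.aestronglyMeasurable
  · refine Eventually.of_forall fun t => ?_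
    simpa using norm_deriv_le_of_lipschitz hγ

variable {V : Type*} [NormedAddCommGroup V] [InnerProductSpace ℝ V] [FiniteDimensional ℝ V]

theorem LipschitzWith.dist_le_integral_norm_deriv {C : ℝ≥0} {γ : ℝ → V} (hγ : LipschitzWith C γ)
    {s t : ℝ} (hst : s ≤ t) : dist (γ s) (γ t) ≤ ∫ r in s..t, ‖deriv γ r‖ := by
  -- Testing against the chord `v` reduces the claim to the fundamental theorem of calculus for a
  -- scalar function.
  set v := γ t - γ s with hv
  have hlip : LipschitzWith (‖innerSL ℝ v‖₊ * C) (fun r => inner ℝ v (γ r) : ℝ → ℝ) :=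
    (innerSL ℝ v).lipschitz.comp hγ
  have hftc := (hlip.lipschitzOnWith (s := uIcc s t)).absolutelyContinuousOnInterval
    |>.integral_deriv_eq_sub
  have hderiv : ∀ᵐ r, deriv (fun r => inner ℝ v (γ r) : ℝ → ℝ) r = inner ℝ v (deriv γ r) := by
    filter_upwards [hγ.ae_differentiableAt] with r hr
    have := (hasDerivAt_const r v).inner ℝ hr.hasDerivAt
    simpa using this.deriv
  have hbound : ‖v‖ * ‖v‖ ≤ ‖v‖ * ∫ r in s..t, ‖deriv γ r‖ := by
    calc ‖v‖ * ‖v‖ = inner ℝ v (γ t) - inner ℝ v (γ s) := by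
          rw [← inner_sub_right, ← hv, real_inner_self_eq_norm_mul_norm]
      _ = ∫ r in s..t, deriv (fun r => inner ℝ v (γ r) : ℝ → ℝ) r := hftc.symm
      _ ≤ ∫ r in s..t, ‖v‖ * ‖deriv γ r‖ := by
          refine intervalIntegral.integral_mono_ae hst ?_
            ((hγ.intervalIntegrable_norm_deriv s t).const_mul _) ?_
          · exact ((hlip.lipschitzOnWith (s := uIcc s t)).absolutelyContinuousOnInterval
              ).intervalIntegrable_deriv
          · filter_upwards [hderiv] with r hr
            rw [hr]
            exact real_inner_le_norm _ _
      _ = _ := intervalIntegral.integral_const_mul _ _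
  rw [dist_comm, dist_eq_norm, ← hv]
  rcases (norm_nonneg v).eq_or_lt' with h | h
  · rw [h]
    exact intervalIntegral.integral_nonneg hst fun _ _ => norm_nonneg _
  · exact le_of_mul_le_mul_left hbound h

/-- A Lipschitz curve can be parametrized with Lipschitz constant close to its length. -/
theorem exists_lipschitzWith_integral_norm_deriv_add {K : Set V} {C : ℝ≥0} {γ : ℝ → V}
    (hγ : LipschitzOnWith C γ (Icc 0 1)) (hγK : MapsTo γ (Icc 0 1) K) {ε : ℝ} (hε : 0 < ε) :
    ∃ γ' : ℝ → V, LipschitzWith ((∫ t in (0 : ℝ)..1, ‖deriv γ t‖) + ε).toNNReal γ' ∧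
      (∀ t, γ' t ∈ K) ∧ γ' 0 = γ 0 ∧ γ' 1 = γ 1 := by
  set η : ℝ → V := fun t => γ (projIcc 0 1 zero_le_one t) with hη
  have hηγ : ∀ t ∈ Icc (0 : ℝ) 1, η t = γ t := fun t ht => by
    simp only [hη, projIcc_of_mem _ ht]
  have hηlip : LipschitzWith C η := by
    refine LipschitzWith.of_dist_le_mul fun s t => ?_
    refine (hγ.dist_le_mul _ (Subtype.coe_prop _) _ (Subtype.coe_prop _)).trans ?_
    exact mul_le_mul_of_nonneg_left (abs_projIcc_sub_projIcc zero_le_one) C.2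
  have hint : ∫ t in (0 : ℝ)..1, ‖deriv γ t‖ = ∫ t in (0 : ℝ)..1, ‖deriv η t‖ := by
    refine intervalIntegral.integral_congr_ae ?_
    filter_upwards [compl_mem_ae_iff.2 (measure_singleton (1 : ℝ))] with t ht1 ht
    rw [uIoc_of_le zero_le_one] at ht
    have hmem : Ioo (0 : ℝ) 1 ∈ 𝓝 t := Ioo_mem_nhds ht.1 (lt_of_le_of_ne ht.2 ht1)
    rw [EventuallyEq.deriv_eq]
    filter_upwards [hmem] with r hr
    exact (hηγ r (Ioo_subset_Icc_self hr)).symm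
  rw [hint]
  -- The term `ε * t` makes arclength strictly increasing even where `γ` stops, so that its inverse
  -- fixes both endpoints.
  set S : ℝ → ℝ := fun t => (∫ r in (0 : ℝ)..t, ‖deriv η r‖) + ε * t with hS
  have hI : ∀ a b, IntervalIntegrable (fun t => ‖deriv η t‖) volume a b :=
    hηlip.intervalIntegrable_norm_deriv
  have hSsub : ∀ s t, S t - S s = (∫ r in s..t, ‖deriv η r‖) + ε * (t - s) := by
    intro s t
    rw [← intervalIntegral.integral_interval_sub_left (hI 0 t) (hI 0 s)]
    simp only [hS]
    ring
  have hScont : Continuous S :=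
    (intervalIntegral.continuous_primitive hI 0).add (continuous_const.mul continuous_id)
  have hSmono : ∀ s t, s ≤ t → ε * (t - s) ≤ S t - S s := by
    intro s t hst
    rw [hSsub]
    exact le_add_of_nonneg_left (intervalIntegral.integral_nonneg hst fun _ _ => norm_nonneg _)
  have hS0 : S 0 = 0 := by simp [hS]
  have hS1 : S 1 = (∫ t in (0 : ℝ)..1, ‖deriv η t‖) + ε := by simp [hS]
  have hS1pos : 0 ≤ S 1 := by
    have := hSmono 0 1 zero_le_one
    linarith
  rw [← hS1]
  have hσ : ∀ r : Icc (0 : ℝ) 1, ∃ t ∈ Icc (0 : ℝ) 1, S t = r * S 1 := fun r =>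
    intermediate_value_Icc zero_le_one hScont.continuousOn
      ⟨by rw [hS0]; exact mul_nonneg r.2.1 hS1pos, mul_le_of_le_one_left hS1pos r.2.2⟩
  choose σ hσI hσS using hσ
  have hdist : ∀ r r' : Icc (0 : ℝ) 1, σ r ≤ σ r' →
      dist (η (σ r)) (η (σ r')) ≤ S 1 * dist r r' := by
    intro r r' h
    refine (hηlip.dist_le_integral_norm_deriv h).trans ?_
    have h1 := hSsub (σ r) (σ r')
    rw [hσS, hσS] at h1
    have h2 : 0 ≤ ε * (σ r' - σ r) := mul_nonneg hε.le (sub_nonneg.2 h)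
    rw [Subtype.dist_eq, dist_comm, Real.dist_eq]
    calc _ ≤ S 1 * ((r' : ℝ) - r) := by linarith
      _ ≤ _ := mul_le_mul_of_nonneg_left (le_abs_self _) hS1pos
  have hends : ∀ a b : ℝ, S a = S b → a ≤ b → a = b := by
    intro a b hab hle
    have h1 := hSmono a b hle
    rw [hab, sub_self] at h1
    have h2 : b - a ≤ 0 := nonpos_of_mul_nonpos_right h1 hε
    linarith
  refine ⟨fun r => η (σ (projIcc 0 1 zero_le_one r)), LipschitzWith.of_dist_le_mul fun r r' => ?_,
    fun r => hγK (Subtype.coe_prop _), ?_, ?_⟩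
  · rw [Real.coe_toNNReal _ hS1pos]
    refine le_trans ?_ (mul_le_mul_of_nonneg_left
      (abs_projIcc_sub_projIcc (h := zero_le_one) (c := r) (d := r')) hS1pos)
    rcases le_total (σ (projIcc 0 1 zero_le_one r)) (σ (projIcc 0 1 zero_le_one r')) with h | h
    · exact hdist _ _ h
    · rw [dist_comm, abs_sub_comm]
      exact hdist _ _ h
  · have h := hσS (projIcc 0 1 zero_le_one 0)
    have h0 : σ (projIcc 0 1 zero_le_one 0) = 0 := by
      refine (hends _ _ ?_ (hσI _).1).symm
      rw [h, hS0]
      simp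
    simp only [h0]
    exact hηγ 0 (by simp)
  · have h := hσS (projIcc 0 1 zero_le_one 1)
    have h0 : σ (projIcc 0 1 zero_le_one 1) = 1 := by
      refine hends _ _ ?_ (hσI _).2
      rw [h]
      simp
    simp only [h0]
    exact hηγ 1 (by simp)

end Arclength

/-! ### Injective curves no longer than the geodesic distance -/

namespace RoadField

theorem geodesicDist_nonneg (K : Set Plane) (x y : Plane) : 0 ≤ geodesicDist K x y := by
  refine Real.sInf_nonneg ?_
  rintro ℓ ⟨γ, -, -, -, -, rfl⟩
  exact intervalIntegral.integral_nonneg zero_le_one fun _ _ => norm_nonneg _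

theorem exists_injective_curve_le_geodesicDist {K : Set Plane} (hK : IsCompact K)
    (hconn : IsPreconnected K) (hfin : Measure.hausdorffMeasure 1 K < ⊤) {x y : Plane}
    (hx : x ∈ K) (hy : y ∈ K) (hxy : x ≠ y) :
    ∃ (L : ℝ≥0) (γ : ℝ → Plane), LipschitzWith L γ ∧ (∀ t, γ t ∈ K) ∧ γ 0 = x ∧ γ 1 = y ∧
      InjOn γ (Icc 0 1) ∧ L ≤ geodesicDist K x y ∧
      L ≤ 4 * (Measure.hausdorffMeasure 1 K).toNNReal := by
  have hex := exists_lipschitz_curve hK hconn hfin hx hy hxy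
  obtain ⟨L, γ, hγ, hγK, h0, h1, hmin⟩ := exists_minimal_lipschitz_curve hK hex
  obtain ⟨γ₀, hγ₀, hγ₀K, h₀0, h₀1⟩ := hex
  refine ⟨L, γ, hγ, hγK, h0, h1, injOn_of_minimal_lipschitz hxy hγ hγK h0 h1 hmin, ?_,
    hmin _ γ₀ hγ₀ hγ₀K h₀0 h₀1⟩
  -- The curve `γ` itself shows that the infimum is not over the empty set. Any competitor,
  -- reparametrized by arclength, has constant at most its length plus `ε`.
  refine le_csInf ⟨_, γ, ⟨L, hγ.lipschitzOnWith⟩, fun t _ => hγK t, h0, h1, rfl⟩ ?_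
  rintro ℓ ⟨η, ⟨C, hη⟩, hηK, hη0, hη1, rfl⟩
  refine le_of_forall_pos_le_add fun ε hε => ?_
  obtain ⟨η', hη', hη'K, hη'0, hη'1⟩ := exists_lipschitzWith_integral_norm_deriv_add hη hηK hε
  have h := hmin _ η' hη' hη'K (hη'0.trans hη0) (hη'1.trans hη1)
  have hpos : 0 ≤ (∫ t in (0 : ℝ)..1, ‖deriv η t‖) + ε :=
    add_nonneg (intervalIntegral.integral_nonneg zero_le_one fun _ _ => norm_nonneg _) hε.le
  rw [← NNReal.coe_le_coe, Real.coe_toNNReal _ hpos] at h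
  exact h

end RoadField

/-! ### The length measure on an injective curve -/

section CurveMeasure

variable {V : Type*} [NormedAddCommGroup V] [NormedSpace ℝ V]

theorem HasDerivAt.tendsto_symmetric_slope {γ : ℝ → V} {d : V} {t : ℝ} (h : HasDerivAt γ d t) :
    Tendsto (fun r : ℝ => ‖γ (t + r) - γ (t - r)‖ / (2 * r)) (𝓝[>] 0) (𝓝 ‖d‖) := by
  have h1 : HasDerivAt (fun r => γ (t + r)) d 0 := by
    simpa using HasDerivAt.comp_const_add t 0 (by simpa using h)
  have h2 : HasDerivAt (fun r => γ (t - r)) (-d) 0 := by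
    simpa using HasDerivAt.comp_const_sub t 0 (by simpa using h)
  have h3 := ((hasDerivAt_iff_tendsto_slope_zero.1 (h1.sub h2)).mono_left
    (nhdsWithin_mono 0 fun r hr => (ne_of_gt hr : r ≠ 0))).norm.div_const 2
  have h4 : ‖d - -d‖ / 2 = ‖d‖ := by
    rw [sub_neg_eq_add, ← two_smul ℝ d, norm_smul]
    simp
  rw [h4] at h3
  refine h3.congr' ?_
  filter_upwards [self_mem_nhdsWithin] with r hr
  have hr' : (0 : ℝ) < r := hr
  simp only [Pi.sub_apply, zero_add, add_zero, sub_zero, sub_self, norm_smul, norm_inv,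
    Real.norm_of_nonneg hr'.le]
  field_simp

/-- An injective curve on a compact interval does not return near `γ t`: parameters outside a
neighbourhood of `t` have a compact image that misses `γ t`. -/
theorem eventually_of_dist_le_of_injOn {X : Type*} [MetricSpace X] {γ : ℝ → X} {a b t : ℝ}
    (hγ : ContinuousOn γ (Icc a b)) (hinj : InjOn γ (Icc a b)) (ht : t ∈ Icc a b) {P : ℝ → Prop}
    (hP : ∀ᶠ s in 𝓝 t, P s) :
    ∀ᶠ r in 𝓝[>] (0 : ℝ), ∀ s ∈ Icc a b, dist (γ s) (γ t) ≤ r → P s := by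
  obtain ⟨U, hUP, hU, htU⟩ := eventually_nhds_iff.1 hP
  have hcpt : IsCompact (γ '' (Icc a b \ U)) :=
    (isCompact_Icc.diff hU).image_of_continuousOn (hγ.mono sdiff_subset)
  have hnot : γ t ∈ (γ '' (Icc a b \ U))ᶜ := by
    rintro ⟨s, hs, hst⟩
    exact hs.2 (hinj hs.1 ht hst ▸ htU)
  obtain ⟨δ, hδ, hball⟩ := Metric.isOpen_iff.1 hcpt.isClosed.isOpen_compl _ hnot
  filter_upwards [Ioo_mem_nhdsGT hδ] with r hr s hs hsr
  refine hUP s ?_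
  by_contra hsU
  exact hball (Metric.mem_ball.2 (hsr.trans_lt hr.2)) ⟨s, ⟨hs, hsU⟩, rfl⟩

theorem LipschitzWith.hausdorffMeasure_one_image_le {X : Type*} [MetricSpace X] [MeasurableSpace X]
    [BorelSpace X] {L : ℝ≥0} {γ : ℝ → X} (hγ : LipschitzWith L γ) (s : Set ℝ) :
    Measure.hausdorffMeasure 1 (γ '' s) ≤ L * volume s := by
  simpa [hausdorffMeasure_real] using hγ.hausdorffMeasure_image_le zero_le_one s

variable [MeasurableSpace V] [BorelSpace V]

/-- The inequality `γ_* (|γ'| dt) ≤ H¹` in the area formula for an injective Lipschitz curve. -/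
theorem map_withDensity_enorm_deriv_le [CompleteSpace V] [SecondCountableTopology V]
    {L : ℝ≥0} {γ : ℝ → V} (hγ : LipschitzWith L γ) (hinj : InjOn γ (Icc 0 1)) :
    ((volume.restrict (Icc 0 1)).withDensity fun t => ‖deriv γ t‖ₑ).map γ ≤
      (Measure.hausdorffMeasure 1).restrict (γ '' Icc 0 1) := by
  have he : MeasurableEmbedding ((Icc (0 : ℝ) 1).domRestrict γ) := by
    refine Topology.IsClosedEmbedding.measurableEmbedding ?_
    exact (hγ.continuous.continuousOn.domRestrict).isClosedEmbedding
      (injOn_iff_injective.1 hinj)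
  -- `ν` is the pullback of `H¹` by the curve. Its Lebesgue density is at least `‖γ'‖`, since the
  -- arc over `[t - r, t + r]` is at least as long as its chord.
  set ν : Measure ℝ :=
    ((Measure.hausdorffMeasure 1 : Measure V).comap ((Icc (0 : ℝ) 1).domRestrict γ)).map Subtype.val
    with hν
  have hνapply : ∀ A, MeasurableSet A →
      ν A = Measure.hausdorffMeasure 1 (γ '' (Icc 0 1 ∩ A)) := by
    intro A hA
    rw [hν, Measure.map_apply measurable_subtype_coe hA, he.comap_apply, domRestrict_eq,
      image_comp, Subtype.image_preimage_coe]
  have hνfin : IsFiniteMeasure ν := by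
    refine ⟨?_⟩
    rw [hνapply _ MeasurableSet.univ, inter_univ]
    refine (hγ.hausdorffMeasure_one_image_le _).trans_lt ?_
    simp
  have hderiv : ∀ᵐ t ∂volume.restrict (Icc (0 : ℝ) 1), ‖deriv γ t‖ₑ ≤ ν.rnDeriv volume t := by
    rw [← restrict_Ioo_eq_restrict_Icc, ae_restrict_iff' measurableSet_Ioo]
    filter_upwards [Besicovitch.ae_tendsto_rnDeriv ν volume] with t ht htI
    by_cases hd : DifferentiableAt ℝ γ t
    swap
    -- The default value `deriv γ t = 0` makes the bound trivial here.
    · simp [deriv_zero_of_not_differentiableAt hd]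
    have h1 := (ENNReal.tendsto_ofReal hd.hasDerivAt.tendsto_symmetric_slope)
    rw [ofReal_norm] at h1
    refine le_of_tendsto_of_tendsto h1 ht ?_
    have hev : ∀ᶠ r in 𝓝[>] (0 : ℝ), r < min t (1 - t) :=
      nhdsWithin_le_nhds (gt_mem_nhds (lt_min htI.1 (by linarith [htI.2])))
    filter_upwards [hev, self_mem_nhdsWithin] with r hr hr0
    have hr0' : (0 : ℝ) < r := hr0
    have hr1 := hr.trans_le (min_le_left _ _)
    have hr2 := hr.trans_le (min_le_right _ _)
    have hsub : Icc (t - r) (t + r) ⊆ Icc 0 1 := Icc_subset_Icc (by linarith) (by linarith)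
    rw [Real.volume_closedBall, ENNReal.ofReal_div_of_pos (by positivity)]
    gcongr
    rw [hνapply _ Metric.isClosed_closedBall.measurableSet, Real.closedBall_eq_Icc,
      inter_eq_right.2 hsub, ofReal_norm, ← edist_eq_enorm_sub]
    exact ((isPreconnected_Icc.image γ hγ.continuous.continuousOn).edist_le_hausdorffMeasure
      (mem_image_of_mem _ (by constructor <;> linarith))
      (mem_image_of_mem _ (by constructor <;> linarith)))
  refine Measure.le_iff.2 fun B hB => ?_
  have hB' : MeasurableSet (γ ⁻¹' B) := hγ.continuous.measurable hB
  rw [Measure.map_apply hγ.continuous.measurable hB, Measure.restrict_apply hB]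
  calc _ = ∫⁻ t in γ ⁻¹' B, ‖deriv γ t‖ₑ ∂volume.restrict (Icc 0 1) := withDensity_apply _ hB'
    _ ≤ ∫⁻ t in γ ⁻¹' B, ν.rnDeriv volume t ∂volume.restrict (Icc 0 1) :=
        lintegral_mono_ae (ae_restrict_of_ae hderiv)
    _ ≤ ∫⁻ t in γ ⁻¹' B, ν.rnDeriv volume t :=
        lintegral_mono' (Measure.restrict_mono le_rfl Measure.restrict_le_self) le_rfl
    _ = volume.withDensity (ν.rnDeriv volume) (γ ⁻¹' B) := (withDensity_apply _ hB').symm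
    _ ≤ ν (γ ⁻¹' B) := Measure.withDensity_rnDeriv_le _ _ _
    _ = _ := by rw [hνapply _ hB', image_inter_preimage, inter_comm]

end CurveMeasure

/-! ### Approximate tangents along a curve -/

namespace RoadField

theorem norm_sub_inner_smul_le {e : Plane} (he : ‖e‖ = 1) (z : Plane) :
    ‖z - (inner ℝ e z : ℝ) • e‖ ≤ 2 * ‖z‖ := by
  have h := abs_real_inner_le_norm e z
  rw [he, one_mul] at h
  calc _ ≤ ‖z‖ + ‖(inner ℝ e z : ℝ) • e‖ := norm_sub_le _ _
    _ = ‖z‖ + |(inner ℝ e z : ℝ)| := by rw [norm_smul, he, mul_one, Real.norm_eq_abs]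
    _ ≤ _ := by linarith

theorem eventually_mem_cone {γ : ℝ → Plane} {t : ℝ} {d : Plane} (h : HasDerivAt γ d t)
    (hd : d ≠ 0) {s : ℝ} (hs0 : 0 < s) (hs1 : s < 1) :
    ∀ᶠ t' in 𝓝 t, t' = t ∨ γ t' ∈ cone (γ t) (‖d‖⁻¹ • d) s := by
  have hd' : 0 < ‖d‖ := norm_pos_iff.2 hd
  set e := ‖d‖⁻¹ • d with he
  have he1 : ‖e‖ = 1 := norm_smul_inv_norm hd
  -- With `X = |t' - t| ‖d‖`, the remainder is at most `s X / 4`. The distance to the axis is then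
  -- at most `s X / 2`, while the displacement is at least `3 X / 4`.
  filter_upwards [(hasDerivAt_iff_isLittleO.1 h).def (c := s * ‖d‖ / 4) (by positivity)]
    with t' ht'
  refine or_iff_not_imp_left.2 fun hne => ?_
  have hpos : 0 < |t' - t| := abs_pos.2 (sub_ne_zero.2 hne)
  set R := γ t' - γ t - (t' - t) • d with hR
  rw [Real.norm_eq_abs] at ht'
  have hy : γ t' - γ t = (t' - t) • d + R := by rw [hR]; abel
  have hde : d = ‖d‖ • e := by rw [he, smul_smul, mul_inv_cancel₀ hd'.ne', one_smul]
  have hproj : (γ t' - γ t) - (inner ℝ e (γ t' - γ t) : ℝ) • e = R - (inner ℝ e R : ℝ) • e := by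
    have h1 : (inner ℝ e d : ℝ) • e = d := by
      conv_lhs => rw [hde]
      rw [inner_smul_right, real_inner_self_eq_norm_sq, he1, one_pow, mul_one, ← hde]
    rw [hy, inner_add_right, inner_smul_right, add_smul, mul_smul, h1]
    abel
  have hlow : |t' - t| * ‖d‖ - ‖R‖ ≤ ‖γ t' - γ t‖ := by
    have := norm_sub_le_norm_add ((t' - t) • d) R
    rwa [norm_smul, Real.norm_eq_abs, ← hy] at this
  change ‖(γ t' - γ t) - (inner ℝ e (γ t' - γ t) : ℝ) • e‖ < s * ‖γ t' - γ t‖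
  rw [hproj]
  have hX : 0 < |t' - t| * ‖d‖ := by positivity
  have hR' : ‖R‖ ≤ s * (|t' - t| * ‖d‖) / 4 := ht'.trans_eq (by ring)
  calc _ ≤ 2 * ‖R‖ := norm_sub_inner_smul_le he1 R
    _ ≤ s * (|t' - t| * ‖d‖) / 2 := by linarith
    _ < s * (|t' - t| * ‖d‖ * (3 / 4)) := by nlinarith [mul_pos hs0 hX]
    _ ≤ s * ‖γ t' - γ t‖ := by
        refine mul_le_mul_of_nonneg_left ?_ hs0.le
        nlinarith

theorem eventually_abs_sub_le {V : Type*} [NormedAddCommGroup V] [NormedSpace ℝ V] {γ : ℝ → V}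
    {t : ℝ} {d : V} (h : HasDerivAt γ d t) (hd : d ≠ 0) :
    ∀ᶠ t' in 𝓝 t, |t' - t| ≤ 2 / ‖d‖ * dist (γ t') (γ t) := by
  have hd' : 0 < ‖d‖ := norm_pos_iff.2 hd
  filter_upwards [(hasDerivAt_iff_isLittleO.1 h).def (c := ‖d‖ / 2) (by positivity)] with t' ht'
  rw [Real.norm_eq_abs] at ht'
  have h1 := norm_sub_norm_le ((t' - t) • d) (γ t' - γ t)
  rw [norm_sub_rev ((t' - t) • d), norm_smul, Real.norm_eq_abs] at h1
  rw [dist_eq_norm, div_mul_eq_mul_div, le_div_iff₀ hd']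
  linarith

/-- Narrow cones around two different lines are disjoint, so their complements cover every ball and
`K` would have density zero at `x`. -/
theorem IsApproxTangent.eq_inner_smul {K : Set Plane} {x e e' : Plane}
    (h : IsApproxTangent K x e) (h' : IsApproxTangent K x e') :
    e' = (inner ℝ e e' : ℝ) • e := by
  by_contra hne
  set η := ‖e' - (inner ℝ e e' : ℝ) • e‖ with hη
  have hη0 : 0 < η := norm_pos_iff.2 (sub_ne_zero.2 hne)
  have hη2 : η ≤ 2 := by
    have := norm_sub_inner_smul_le h.norm_eq_one e'
    rwa [h'.norm_eq_one, mul_one] at this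
  -- With opening `η / 8`, a common point `y` would have `|a| ≤ 3 / 8 ‖y‖` and, as `η ≤ 2`, also
  -- `|a| ≥ 3 / 4 ‖y‖`.
  have hs0 : 0 < η / 8 := by positivity
  have hs1 : η / 8 < 1 := by linarith
  have hdisj : Disjoint (cone x e (η / 8)) (cone x e' (η / 8)) := by
    rw [Set.disjoint_left]
    intro z hz hz'
    change ‖_‖ < _ at hz
    change ‖_‖ < _ at hz'
    set y := z - x
    set R := y - (inner ℝ e' y : ℝ) • e' with hR
    set a : ℝ := inner ℝ e' y
    have hy : y = a • e' + R := by rw [hR]; abel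
    have hy0 : 0 < ‖y‖ := by
      have : 0 < η / 8 * ‖y‖ := (norm_nonneg _).trans_lt hz
      exact pos_of_mul_pos_right this hs0.le
    have hPy : a • (e' - (inner ℝ e e' : ℝ) • e) =
        (y - (inner ℝ e y : ℝ) • e) - (R - (inner ℝ e R : ℝ) • e) := by
      have : (inner ℝ e y : ℝ) = a * inner ℝ e e' + inner ℝ e R := by
        conv_lhs => rw [hy]
        rw [inner_add_right, inner_smul_right]
      rw [this, smul_sub, smul_smul, add_smul]
      conv_rhs => rw [hy]
      abel
    have h1 : |a| * η ≤ 3 * (η / 8 * ‖y‖) := by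
      calc |a| * η = ‖a • (e' - (inner ℝ e e' : ℝ) • e)‖ := by rw [norm_smul, Real.norm_eq_abs]
        _ ≤ ‖y - (inner ℝ e y : ℝ) • e‖ + ‖R - (inner ℝ e R : ℝ) • e‖ := by
            rw [hPy]; exact norm_sub_le _ _
        _ ≤ η / 8 * ‖y‖ + 2 * (η / 8 * ‖y‖) :=
            add_le_add hz.le ((norm_sub_inner_smul_le h.norm_eq_one R).trans (by linarith))
        _ = _ := by ring
    have h2 : ‖y‖ ≤ |a| + η / 8 * ‖y‖ := by
      calc ‖y‖ = ‖a • e' + R‖ := by rw [← hy]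
        _ ≤ ‖a • e'‖ + ‖R‖ := norm_add_le _ _
        _ ≤ _ := by
          rw [norm_smul, h'.norm_eq_one, mul_one, Real.norm_eq_abs]
          linarith
    have h3 : |a| ≤ 3 / 8 * ‖y‖ := by
      refine le_of_mul_le_mul_right (a := η) ?_ hη0
      linarith
    nlinarith
  have hsum := (h.density_outside_cone _ hs0 hs1).add (h'.density_outside_cone _ hs0 hs1)
  rw [add_zero] at hsum
  have hlim : Tendsto (fun r : ℝ =>
      lengthMeasure K (Metric.closedBall x r) / ENNReal.ofReal r) (𝓝[>] 0) (𝓝 0) := by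
    refine tendsto_of_tendsto_of_tendsto_of_le_of_le tendsto_const_nhds hsum
      (fun _ => zero_le) fun r => ?_
    simp only
    rw [← ENNReal.add_div]
    gcongr
    refine (measure_mono ?_).trans (measure_union_le _ _)
    intro z hz
    by_cases hzc : z ∈ cone x e (η / 8)
    · exact Or.inr ⟨hz, Set.disjoint_left.1 hdisj hzc⟩
    · exact Or.inl ⟨hz, hzc⟩
  exact h.upper_density_pos.ne' hlim.limsup_eq

theorem limsup_density_pos {K : Set Plane} (hK : MeasurableSet K) (hconn : IsPreconnected K)
    {x y : Plane} (hx : x ∈ K) (hy : y ∈ K) (hxy : x ≠ y) :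
    0 < limsup (fun r : ℝ => lengthMeasure K (Metric.closedBall x r) / ENNReal.ofReal r)
      (𝓝[>] 0) := by
  refine zero_lt_one.trans_le (le_trans ?_ liminf_le_limsup)
  refine le_liminf_of_le (h := ?_)
  filter_upwards [Ioo_mem_nhdsGT (dist_pos.2 hxy.symm)] with r hr
  have hr0 : ENNReal.ofReal r ≠ 0 := (ENNReal.ofReal_pos.2 hr.1).ne'
  rw [ENNReal.le_div_iff_mul_le (Or.inl hr0) (Or.inl ENNReal.ofReal_ne_top), one_mul,
    lengthMeasure, Measure.restrict_apply' hK, inter_comm]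
  exact hconn.ofReal_le_hausdorffMeasure_inter_closedBall hx hy hr.2.le

/-- A point of an injective curve in `K` where the curve has a nonzero derivative, and where the
rest of `K` has relative density zero, is a point where `K` has an approximate tangent. -/
theorem isApproxTangent_of_hasDerivAt {K : Set Plane} (hK : IsCompact K)
    (hconn : IsPreconnected K) (hfin : Measure.hausdorffMeasure 1 K < ⊤) {L : ℝ≥0}
    {γ : ℝ → Plane} (hγ : LipschitzWith L γ) (hγK : ∀ t, γ t ∈ K) (hinj : InjOn γ (Icc 0 1))
    {t : ℝ} (ht : t ∈ Ioo (0 : ℝ) 1) {d : Plane} (hd : d ≠ 0) (hderiv : HasDerivAt γ d t)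
    (hdens : Tendsto (fun r => (lengthMeasure K).restrict (γ '' Icc 0 1)ᶜ
        (Metric.closedBall (γ t) r) /
      (lengthMeasure K).restrict (γ '' Icc 0 1) (Metric.closedBall (γ t) r)) (𝓝[>] 0) (𝓝 0)) :
    IsApproxTangent K (γ t) (‖d‖⁻¹ • d) := by
  have hd' : 0 < ‖d‖ := norm_pos_iff.2 hd
  have htI := Ioo_subset_Icc_self ht
  have hΓ : MeasurableSet (γ '' Icc 0 1) :=
    (isCompact_Icc.image hγ.continuous).isClosed.measurableSet
  have hfin' : IsFiniteMeasure (lengthMeasure K) := ⟨by simpa [lengthMeasure] using hfin⟩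
  have hne : γ t ≠ γ 0 := fun h => ht.1.ne' (hinj htI (by simp) h)
  refine ⟨norm_smul_inv_norm hd,
    limsup_density_pos hK.isClosed.measurableSet hconn (hγK t) (hγK 0) hne,
    fun s hs0 hs1 => ?_⟩
  set κ := lengthMeasure K with hκ
  set Γ := γ '' Icc (0 : ℝ) 1 with hΓdef
  -- Near `γ t`, the curve lies in the ball of radius `r` only for parameters in an interval of
  -- length `4 r / ‖d‖`.
  set C : ℝ≥0∞ := L * ENNReal.ofReal (4 / ‖d‖) with hC
  have hCtop : C ≠ ⊤ := ENNReal.mul_ne_top ENNReal.coe_ne_top ENNReal.ofReal_ne_top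
  have hlim := ENNReal.Tendsto.mul_const hdens (Or.inr hCtop)
  rw [zero_mul] at hlim
  refine tendsto_of_tendsto_of_tendsto_of_le_of_le' tendsto_const_nhds hlim
    (Eventually.of_forall fun _ => zero_le) ?_
  filter_upwards [self_mem_nhdsWithin, hdens.eventually_ne ENNReal.zero_ne_top,
    eventually_of_dist_le_of_injOn hγ.continuous.continuousOn hinj htI
      (eventually_mem_cone hderiv hd hs0 hs1),
    eventually_of_dist_le_of_injOn hγ.continuous.continuousOn hinj htI
      (eventually_abs_sub_le hderiv hd)] with r hr hq hcone hnear
  have hr0 : (0 : ℝ) < r := hr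
  set B := Metric.closedBall (γ t) r with hB
  set q := κ.restrict Γᶜ B / κ.restrict Γ B with hqdef
  have hBm : MeasurableSet B := Metric.isClosed_closedBall.measurableSet
  -- Finiteness of `q` rules out a positive numerator over zero, so the denominator need not be
  -- known to be nonzero.
  have hout : κ.restrict Γᶜ B ≤ q * κ.restrict Γ B :=
    (ENNReal.div_le_iff_le_mul (Or.inr hq) (Or.inl (measure_ne_top _ _))).1 le_rfl
  have hin : κ.restrict Γ B ≤ C * ENNReal.ofReal r := by
    have hsub : B ∩ Γ ⊆ γ '' Metric.closedBall t (2 / ‖d‖ * r) := by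
      rintro _ ⟨hz, t', ht', rfl⟩
      refine ⟨t', ?_, rfl⟩
      rw [Metric.mem_closedBall, Real.dist_eq]
      refine (hnear t' ht' hz).trans ?_
      gcongr
      exact hz
    calc κ.restrict Γ B = κ (B ∩ Γ) := Measure.restrict_apply hBm
      _ ≤ Measure.hausdorffMeasure 1 (B ∩ Γ) := Measure.restrict_le_self _
      _ ≤ L * volume (Metric.closedBall t (2 / ‖d‖ * r)) :=
          (measure_mono hsub).trans (hγ.hausdorffMeasure_one_image_le _)
      _ = C * ENNReal.ofReal r := by
          rw [Real.volume_closedBall, hC, mul_assoc, ← ENNReal.ofReal_mul (by positivity)]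
          congr 2
          ring
  -- In small balls only the vertex `γ t` of the curve is outside the open cone, and `H¹` has no
  -- atoms.
  have hcone0 : κ ((B \ cone (γ t) (‖d‖⁻¹ • d) s) ∩ Γ) = 0 := by
    have hatom : κ {γ t} = 0 := by
      have := Measure.nullSingletonClass_hausdorff Plane (d := 1) one_pos
      exact nonpos_iff_eq_zero.1 ((Measure.restrict_le_self _).trans_eq (measure_singleton (γ t)))
    refine measure_mono_null ?_ hatom
    rintro _ ⟨⟨hz, hzc⟩, t', ht', rfl⟩
    rcases hcone t' ht' hz with h | h
    · rw [h]; rfl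
    · exact absurd h hzc
  have hr0' : ENNReal.ofReal r ≠ 0 := (ENNReal.ofReal_pos.2 hr0).ne'
  rw [ENNReal.div_le_iff_le_mul (Or.inl hr0') (Or.inl ENNReal.ofReal_ne_top)]
  calc κ (B \ cone (γ t) (‖d‖⁻¹ • d) s)
      ≤ κ ((B \ cone (γ t) (‖d‖⁻¹ • d) s) ∩ Γ) + κ (B ∩ Γᶜ) := by
        refine (measure_mono ?_).trans (measure_union_le _ _)
        intro z hz
        by_cases hzΓ : z ∈ Γ
        · exact Or.inl ⟨hz, hzΓ⟩
        · exact Or.inr ⟨hz.1, hzΓ⟩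
    _ = κ.restrict Γᶜ B := by rw [hcone0, zero_add, Measure.restrict_apply hBm]
    _ ≤ q * κ.restrict Γ B := hout
    _ ≤ q * (C * ENNReal.ofReal r) := by gcongr
    _ = q * C * ENNReal.ofReal r := (mul_assoc _ _ _).symm

/-- The chosen tangent and `d` span the same line by uniqueness; the absolute value removes the
arbitrary sign. -/
theorem abs_inner_le_of_isApproxTangent {K : Set Plane} {x d : Plane} (hx : x ∈ K)
    (h : IsApproxTangent K x (‖d‖⁻¹ • d)) (φ : Plane → ℝ) :
    |(inner ℝ (gradient φ x) d : ℝ)| ≤ ‖smoothTangentialGradient K φ x‖ * ‖d‖ := by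
  have hd : ‖d‖ ≠ 0 := by
    intro h0
    have := h.norm_eq_one
    simp [h0] at this
  have hex : ∃ e : Plane, x ∈ K ∧ IsApproxTangent K x e := ⟨_, hx, h⟩
  have hτ : IsApproxTangent K x (tangent K x) := by
    rw [tangent, dif_pos hex]
    exact hex.choose_spec.2
  set τ := tangent K x
  set e := ‖d‖⁻¹ • d with he
  have hde : d = ‖d‖ • e := by rw [he, smul_smul, mul_inv_cancel₀ hd, one_smul]
  have hc : |(inner ℝ τ e : ℝ)| ≤ 1 := by
    have := abs_real_inner_le_norm τ e
    rwa [hτ.norm_eq_one, h.norm_eq_one, mul_one] at this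
  have hg : ‖smoothTangentialGradient K φ x‖ = |(inner ℝ (gradient φ x) τ : ℝ)| := by
    change ‖(inner ℝ (gradient φ x) τ : ℝ) • τ‖ = _
    rw [norm_smul, hτ.norm_eq_one, mul_one, Real.norm_eq_abs]
  have hin : (inner ℝ (gradient φ x) d : ℝ) =
      ‖d‖ * (inner ℝ τ e * inner ℝ (gradient φ x) τ) := by
    conv_lhs => rw [hde, inner_smul_right, hτ.eq_inner_smul h, inner_smul_right]
  rw [hin, hg, abs_mul, abs_mul, abs_norm, mul_comm]
  refine mul_le_mul_of_nonneg_right ?_ (norm_nonneg _)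
  exact mul_le_of_le_one_left (abs_nonneg _) hc

end RoadField

/-! ### The estimate for smooth functions and passage to the limit -/

namespace RoadField

theorem abs_sub_le_of_injective_curve {K : Set Plane} (hK : IsCompact K)
    (hconn : IsPreconnected K) (hfin : Measure.hausdorffMeasure 1 K < ⊤) {L : ℝ≥0}
    {γ : ℝ → Plane} (hγ : LipschitzWith L γ) (hγK : ∀ t, γ t ∈ K) (hinj : InjOn γ (Icc 0 1))
    {φ : Plane → ℝ} (hφ : ContDiff ℝ ∞ φ) {g : Lp Plane 2 (lengthMeasure K)}
    (hg : g =ᵐ[lengthMeasure K] smoothTangentialGradient K φ) :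
    |φ (γ 0) - φ (γ 1)| ≤ (L : ℝ) ^ (1 / 2 : ℝ) * ‖g‖ := by
  set Γ := γ '' Icc (0 : ℝ) 1 with hΓdef
  have hΓ : MeasurableSet Γ := (isCompact_Icc.image hγ.continuous).isClosed.measurableSet
  have hΓK : Γ ⊆ K := by
    rintro _ ⟨t, -, rfl⟩
    exact hγK t
  have hKfin : IsFiniteMeasure (lengthMeasure K) := ⟨by simpa [lengthMeasure] using hfin⟩
  have hKΓ : (lengthMeasure K).restrict Γ = (Measure.hausdorffMeasure 1 : Measure Plane).restrict Γ := by
    rw [lengthMeasure, Measure.restrict_restrict hΓ, inter_eq_left.2 hΓK]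
  have hmeas : Measurable fun t => ‖deriv γ t‖ₑ := (measurable_deriv γ).enorm
  set μ := (volume.restrict (Icc (0 : ℝ) 1)).withDensity fun t => ‖deriv γ t‖ₑ with hμ
  have hle : μ.map γ ≤ (lengthMeasure K).restrict Γ := hKΓ ▸ map_withDensity_enorm_deriv_le hγ hinj
  have hle' : μ.map γ ≤ lengthMeasure K := hle.trans Measure.restrict_le_self
  have hsing : (lengthMeasure K).restrict Γᶜ ⟂ₘ (lengthMeasure K).restrict Γ :=
    ⟨Γ, hΓ, by simp [Measure.restrict_apply hΓ], by simp [Measure.restrict_apply hΓ.compl]⟩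
  -- The measures on the curve and on the rest of `K` are mutually singular, so the derivative of
  -- the latter by the former vanishes almost everywhere.
  have hdens : ∀ᵐ z ∂(lengthMeasure K).restrict Γ, Tendsto (fun r => (lengthMeasure K).restrict Γᶜ (Metric.closedBall z r) /
      (lengthMeasure K).restrict Γ (Metric.closedBall z r)) (𝓝[>] 0) (𝓝 0) := by
    have := hsing.haveLebesgueDecomposition
    filter_upwards [Besicovitch.ae_tendsto_rnDeriv ((lengthMeasure K).restrict Γᶜ) ((lengthMeasure K).restrict Γ),
      (Measure.rnDeriv_eq_zero _ _).2 hsing] with z hz hz0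
    rwa [hz0] at hz
  -- `H¹`-null sets pull back to null sets of `|γ'| dt` only, hence the restriction to `γ' ≠ 0`.
  have hcurve : ∀ᵐ t ∂volume.restrict (Icc (0 : ℝ) 1), ‖deriv γ t‖ₑ ≠ 0 →
      Tendsto (fun r => (lengthMeasure K).restrict Γᶜ (Metric.closedBall (γ t) r) /
        (lengthMeasure K).restrict Γ (Metric.closedBall (γ t) r)) (𝓝[>] 0) (𝓝 0) ∧
      g (γ t) = smoothTangentialGradient K φ (γ t) := by
    refine (ae_withDensity_iff hmeas).1 ?_
    exact (ae_of_ae_map hγ.continuous.aemeasurable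
      ((Measure.absolutelyContinuous_of_le hle).ae_le hdens)).and
      (ae_of_ae_map hγ.continuous.aemeasurable
        ((Measure.absolutelyContinuous_of_le hle').ae_le hg))
  obtain ⟨M, hM⟩ := LocallyLipschitzOn.exists_lipschitzOnWith_of_compact hK
    (hφ.of_le (by simp)).locallyLipschitz.locallyLipschitzOn
  have hφγ : LipschitzWith (M * L) (φ ∘ γ) := by
    rw [← lipschitzOnWith_univ]
    exact hM.comp hγ.lipschitzOnWith fun t _ => hγK t
  have hpt : ∀ᵐ t ∂volume.restrict (Icc (0 : ℝ) 1),
      ‖deriv (φ ∘ γ) t‖ₑ ≤ ‖deriv γ t‖ₑ * ‖g (γ t)‖ₑ := by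
    have hIoo : ∀ᵐ t ∂volume.restrict (Icc (0 : ℝ) 1), t ∈ Ioo (0 : ℝ) 1 := by
      rw [← restrict_Ioo_eq_restrict_Icc]
      exact ae_restrict_mem measurableSet_Ioo
    filter_upwards [hIoo, ae_restrict_of_ae hγ.ae_differentiableAt, hcurve] with t htI htd ht
    have hcomp : deriv (φ ∘ γ) t = inner ℝ (gradient φ (γ t)) (deriv γ t) := by
      have h1 := (hφ.differentiable (by simp) (γ t)).hasFDerivAt.comp_hasDerivAt t htd.hasDerivAt
      rw [h1.deriv, gradient, InnerProductSpace.toDual_symm_apply]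
    rw [hcomp]
    by_cases h0 : deriv γ t = 0
    · simp [h0]
    obtain ⟨hd, hgt⟩ := ht (by simpa using h0)
    have htan := isApproxTangent_of_hasDerivAt hK hconn hfin hγ hγK hinj htI h0 htd.hasDerivAt hd
    have h2 := abs_inner_le_of_isApproxTangent (hγK t) htan φ
    rw [← hgt, mul_comm] at h2
    simp only [← ofReal_norm]
    rw [← ENNReal.ofReal_mul (norm_nonneg _)]
    exact ENNReal.ofReal_le_ofReal h2
  have hmass : μ univ ≤ L := by
    rw [hμ, withDensity_apply _ MeasurableSet.univ, Measure.restrict_univ]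
    calc ∫⁻ t in Icc (0 : ℝ) 1, ‖deriv γ t‖ₑ ≤ ∫⁻ _ in Icc (0 : ℝ) 1, (L : ℝ≥0∞) := by
          refine lintegral_mono fun t => ?_
          rw [← ofReal_norm, ← ENNReal.ofReal_coe_nnreal]
          exact ENNReal.ofReal_le_ofReal (norm_deriv_le_of_lipschitz hγ)
      _ = L := by simp
  have hgm : StronglyMeasurable g := Lp.stronglyMeasurable g
  have hmain : ‖φ (γ 1) - φ (γ 0)‖ₑ ≤ eLpNorm g 2 (lengthMeasure K) * (L : ℝ≥0∞) ^ (1 / 2 : ℝ) := by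
    have hftc := (hφγ.lipschitzOnWith (s := uIcc 0 1)).absolutelyContinuousOnInterval
      |>.integral_deriv_eq_sub
    rw [intervalIntegral.integral_of_le zero_le_one] at hftc
    change _ = φ (γ 1) - φ (γ 0) at hftc
    rw [← hftc]
    calc ‖∫ t in Ioc (0 : ℝ) 1, deriv (φ ∘ γ) t‖ₑ
        ≤ ∫⁻ t in Ioc (0 : ℝ) 1, ‖deriv (φ ∘ γ) t‖ₑ := enorm_integral_le_lintegral_enorm _
      _ ≤ ∫⁻ t in Icc (0 : ℝ) 1, ‖deriv (φ ∘ γ) t‖ₑ :=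
          lintegral_mono_set Ioc_subset_Icc_self
      _ ≤ ∫⁻ t in Icc (0 : ℝ) 1, ‖deriv γ t‖ₑ * ‖g (γ t)‖ₑ := lintegral_mono_ae hpt
      _ = ∫⁻ t, ‖g (γ t)‖ₑ ∂μ :=
          (lintegral_withDensity_eq_lintegral_mul _ hmeas
            (hgm.measurable.enorm.comp hγ.continuous.measurable)).symm
      _ = eLpNorm g 1 (μ.map γ) := by
          rw [eLpNorm_one_eq_lintegral_enorm,
            lintegral_map hgm.measurable.enorm hγ.continuous.measurable]
      -- Cauchy–Schwarz for a measure of mass at most `L`.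
      _ ≤ eLpNorm g 2 (μ.map γ) * μ.map γ univ ^ (1 / (1 : ℝ≥0∞).toReal - 1 / (2 : ℝ≥0∞).toReal) :=
          eLpNorm_le_eLpNorm_mul_rpow_measure_univ one_le_two hgm.aestronglyMeasurable
      _ ≤ eLpNorm g 2 (lengthMeasure K) * (L : ℝ≥0∞) ^ (1 / 2 : ℝ) := by
          rw [Measure.map_apply hγ.continuous.measurable MeasurableSet.univ, preimage_univ,
            show 1 / (1 : ℝ≥0∞).toReal - 1 / (2 : ℝ≥0∞).toReal = (1 / 2 : ℝ) by norm_num]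
          exact mul_le_mul' (eLpNorm_mono_measure _ hle')
            (ENNReal.rpow_le_rpow hmass (by norm_num))
  have hreal := ENNReal.toReal_mono (ENNReal.mul_ne_top (Lp.eLpNorm_ne_top g)
    (ENNReal.rpow_ne_top_of_nonneg (by norm_num) ENNReal.coe_ne_top)) hmain
  rw [toReal_enorm, ENNReal.toReal_mul, ← ENNReal.toReal_rpow, ENNReal.coe_toReal, ← Lp.norm_def,
    norm_sub_rev, Real.norm_eq_abs, mul_comm] at hreal
  exact hreal

/-- The estimate for smooth functions, with a constant that depends only on the two points. -/
theorem exists_le_geodesicDist_abs_sub_le {K : Set Plane} (hK : IsCompact K)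
    (hconn : IsPreconnected K) (hfin : Measure.hausdorffMeasure 1 K < ⊤) {x y : Plane}
    (hx : x ∈ K) (hy : y ∈ K) :
    ∃ L : ℝ≥0, L ≤ geodesicDist K x y ∧ L ≤ 4 * (Measure.hausdorffMeasure 1 K).toNNReal ∧
      ∀ φ : Plane → ℝ, ContDiff ℝ ∞ φ → ∀ g : Lp Plane 2 (lengthMeasure K),
        g =ᵐ[lengthMeasure K] smoothTangentialGradient K φ →
        |φ x - φ y| ≤ (L : ℝ) ^ (1 / 2 : ℝ) * ‖g‖ := by
  rcases eq_or_ne x y with rfl | hxy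
  · refine ⟨0, geodesicDist_nonneg K x x, zero_le, fun φ _ g _ => ?_⟩
    simp
  · obtain ⟨L, γ, hγ, hγK, h0, h1, hinj, hL, hL'⟩ :=
      exists_injective_curve_le_geodesicDist hK hconn hfin hx hy hxy
    refine ⟨L, hL, hL', fun φ hφ g hg => ?_⟩
    rw [← h0, ← h1]
    exact abs_sub_le_of_injective_curve hK hconn hfin hγ hγK hinj hφ hg

theorem exists_smooth_approximation {K : Set Plane} (u : SobolevH1 K) :
    ∃ (p : ℕ → L2Pair K) (φ : ℕ → Plane → ℝ), Tendsto p atTop (𝓝 (u : L2Pair K)) ∧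
      (∀ n, ContDiff ℝ ∞ (φ n)) ∧
      (∀ n, (p n).snd =ᵐ[lengthMeasure K] smoothTangentialGradient K (φ n)) ∧
      ∀ᵐ x ∂lengthMeasure K, Tendsto (fun n => φ n x) atTop (𝓝 (toL2 u x)) := by
  obtain ⟨p, hp, hlim⟩ := mem_closure_iff_seq_limit.1
    (show (u : L2Pair K) ∈ closure (smoothPairs K : Set (L2Pair K)) from u.2)
  have hp' : ∀ n, ∃ φ : Plane → ℝ, ContDiff ℝ ∞ φ ∧ ((p n).fst : Plane → ℝ) =ᵐ[lengthMeasure K] φ ∧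
      ((p n).snd : Plane → Plane) =ᵐ[lengthMeasure K] smoothTangentialGradient K φ := hp
  choose φ hφ h1 h2 using hp'
  have hfst : Tendsto (fun n => (p n).fst) atTop (𝓝 (toL2 u)) :=
    ((WithLp.continuous_fst 2 _ _).tendsto _).comp hlim
  obtain ⟨k, hk, hae⟩ := (tendstoInMeasure_of_tendsto_Lp hfst).exists_seq_tendsto_ae
  refine ⟨p ∘ k, φ ∘ k, hlim.comp hk.tendsto_atTop, fun n => hφ _, fun n => h2 _, ?_⟩
  filter_upwards [hae, ae_all_iff.2 h1] with x hx hx'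
  exact hx.congr fun n => hx' (k n)

end RoadField

open MeasureTheory Set in
theorem proposition2p2 (K : Set RoadField.Plane) (hK : IsCompact K) (hconn : IsConnected K)
    (hfin : Measure.hausdorffMeasure 1 K < ⊤) (u : RoadField.SobolevH1 K) :
    (∃ Z : Set RoadField.Plane, Measure.hausdorffMeasure 1 Z = 0 ∧
      ∀ x ∈ K \ Z, ∀ y ∈ K \ Z,
        |RoadField.toL2 u x - RoadField.toL2 u y| ≤
          RoadField.geodesicDist K x y ^ (1 / 2 : ℝ) * ‖RoadField.tangentialGradient u‖) ∧
    ∃ v : RoadField.Plane → ℝ, ContinuousOn v K ∧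
      RoadField.toL2 u =ᵐ[RoadField.lengthMeasure K] v := by
  obtain ⟨p, φ, hp, hφ, hsnd, hae⟩ := RoadField.exists_smooth_approximation u
  have hgrad : Tendsto (fun n => (p n).snd) atTop (𝓝 (RoadField.tangentialGradient u)) :=
    ((WithLp.continuous_snd 2 _ _).tendsto _).comp hp
  have hae' := (ae_restrict_iff' hK.isClosed.measurableSet).1 hae
  refine ⟨⟨_, hae', fun x hx y hy => ?_⟩, ?_⟩
  · have hlim : ∀ z ∈ K \ {z | z ∈ K → Tendsto (fun n => φ n z) atTop
        (𝓝 (RoadField.toL2 u z))}ᶜ, Tendsto (fun n => φ n z) atTop (𝓝 (RoadField.toL2 u z)) :=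
      fun z hz => not_not.1 hz.2 hz.1
    obtain ⟨L, hL, -, h⟩ :=
      RoadField.exists_le_geodesicDist_abs_sub_le hK hconn.isPreconnected hfin hx.1 hy.1
    have h1 := le_of_tendsto_of_tendsto' ((hlim x hx).sub (hlim y hy)).abs
      (hgrad.norm.const_mul ((L : ℝ) ^ (1 / 2 : ℝ))) fun n => h _ (hφ n) _ (hsnd n)
    refine h1.trans ?_
    gcongr
  -- If `H¹(K) = 0`, for instance for a single point, no base point of convergence need exist, but
  -- every function will do.
  · rcases eq_or_ne (RoadField.lengthMeasure K) 0 with h0 | h0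
    · exact ⟨0, continuousOn_const, by simp [EventuallyEq, ae_eq_bot.2 h0]⟩
    have hne : NeBot (ae (RoadField.lengthMeasure K)) := ae_neBot.2 h0
    obtain ⟨y, hy, hyK⟩ :=
      (hae.and (ae_restrict_mem hK.isClosed.measurableSet)).exists
    -- Unlike the geodesic distance, this bound does not depend on the two points, which gives
    -- uniform convergence.
    set C : ℝ := ((4 * (Measure.hausdorffMeasure 1 K).toNNReal : NNReal) : ℝ) ^ (1 / 2 : ℝ)
    have hdiff : ∀ n m, ∀ x ∈ K, dist (φ n x) (φ m x) ≤
        C * ‖(p n).snd - (p m).snd‖ + |φ n y - φ m y| := by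
      intro n m x hx
      obtain ⟨L, -, hL, h⟩ :=
        RoadField.exists_le_geodesicDist_abs_sub_le hK hconn.isPreconnected hfin hx hyK
      have hsub : ((p n).snd - (p m).snd : Lp _ 2 (RoadField.lengthMeasure K))
          =ᵐ[RoadField.lengthMeasure K]
          RoadField.smoothTangentialGradient K (φ n - φ m) := by
        refine (Lp.coeFn_sub _ _).trans ?_
        filter_upwards [hsnd n, hsnd m] with z hz hz'
        have hgr : gradient (φ n - φ m) z = gradient (φ n) z - gradient (φ m) z := by
          simp only [gradient]
          rw [fderiv_sub ((hφ n).differentiable (by simp) z) ((hφ m).differentiable (by simp) z),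
            map_sub]
        simp [RoadField.smoothTangentialGradient, hgr, hz, hz', inner_sub_left, sub_smul]
      have h1 := h _ ((hφ n).sub (hφ m)) _ hsub
      have h2 : (L : ℝ) ^ (1 / 2 : ℝ) ≤ C :=
        Real.rpow_le_rpow L.2 (NNReal.coe_le_coe.2 hL) (by norm_num)
      have h3 := h1.trans (mul_le_mul_of_nonneg_right h2 (norm_nonneg _))
      rw [Real.dist_eq]
      have h4 := abs_sub_abs_le_abs_sub (φ n x - φ m x) (φ n y - φ m y)
      linarith
    have hcauchy : UniformCauchySeqOn φ atTop K := by
      rw [Metric.uniformCauchySeqOn_iff]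
      intro ε hε
      have hlim0 : Tendsto (fun q : ℕ × ℕ => C * ‖(p q.1).snd - (p q.2).snd‖ +
          |φ q.1 y - φ q.2 y|) (atTop ×ˢ atTop) (𝓝 0) := by
        have hf1 := hgrad.comp (tendsto_fst (f := (atTop : Filter ℕ)) (g := (atTop : Filter ℕ)))
        have hf2 := hgrad.comp (tendsto_snd (f := (atTop : Filter ℕ)) (g := (atTop : Filter ℕ)))
        have hy1 := hy.comp (tendsto_fst (f := (atTop : Filter ℕ)) (g := (atTop : Filter ℕ)))
        have hy2 := hy.comp (tendsto_snd (f := (atTop : Filter ℕ)) (g := (atTop : Filter ℕ)))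
        simpa using ((hf1.sub hf2).norm.const_mul C).add (hy1.sub hy2).abs
      rw [prod_atTop_atTop_eq] at hlim0
      obtain ⟨⟨N₁, N₂⟩, hN⟩ := eventually_atTop.1 (hlim0.eventually_lt_const hε)
      refine ⟨max N₁ N₂, fun m hm n hn x hx => (hdiff m n x hx).trans_lt (hN (m, n) ⟨?_, ?_⟩)⟩
      · exact (le_max_left _ _).trans hm
      · exact (le_max_right _ _).trans hn
    have hpt : ∀ x, ∃ l, x ∈ K → Tendsto (fun n => φ n x) atTop (𝓝 l) := by
      intro x
      by_cases hx : x ∈ K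
      · obtain ⟨l, hl⟩ := cauchySeq_tendsto_of_complete (hcauchy.cauchySeq hx)
        exact ⟨l, fun _ => hl⟩
      · exact ⟨0, fun h => absurd h hx⟩
    choose v hv using hpt
    refine ⟨v, (hcauchy.tendstoUniformlyOn_of_tendsto hv).continuousOn
      (Eventually.of_forall fun n => (hφ n).continuous.continuousOn).frequently, ?_⟩
    filter_upwards [hae, ae_restrict_mem hK.isClosed.measurableSet] with x hx hxK
    exact tendsto_nhds_unique hx (hv x hxK)
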